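/- For integers $0\le n<m$ let $Y$ be an $m\times m$ matrix of variables, $X$ a principal $n\times n$ submatrix of $Y$, and $y$ a diagonal entry of $Y$ outside $X$. Let $V=\mathrm{Sym}^m(Y)$ be the space of complex forms of degree $m$ in the $m^2$ entries of $Y$, on which $G=GL_{m^2}(\mathbb{C})$ acts by $(gf)(Y)=f(g^{-1}Y)$. Let $X_{NC}(n,m)\subseteq\mathbb{P}(V)$ be the Zariski closure of the $G$-orbit of $[\det(Y)]$, and let $X_{\#P}(n,m)\subseteq\mathbb{P}(V)$ be the Zariski closure of the $G$-orbit of $[y^{m-n}\,\mathrm{perm}(X)]$. For a partition $\lambda$ of length at most $m^2$, the Weyl module $V_\lambda(G)$ (the irreducible polynomial representation of $G$ indexed by $\lambda$) is said to live on one of these varieties if it occurs as a subrepresentation of $G$ in the homogeneous coordinate ring of that variety. A (geometric) obstruction for $(n,m)$ is a Weyl module $V_\lambda(G)$ that lives on $X_{\#P}(n,m)$ but not on $X_{NC}(n,m)$. Proposition. (i) If $n<m$ and there is an obstruction for $(n,m)$, then the permanent $\mathrm{perm}(X)$ of an $n\times n$ variable matrix $X$ is not equal to the determinant of any $m\times m$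 matrix whose entries are (possibly nonhomogeneous) linear functions over $\mathbb{C}$ of the entries of $X$. (ii) In particular, let $a>1$ be fixed and $m(n)=\lceil 2^{(\log_2 n)^a}\rceil$. If for all sufficiently large $n$ there is an obstruction for $(n,m(n))$, then for all sufficiently large $n$ the permanent $\mathrm{perm}(X)$ of an $n\times n$ variable matrix cannot be written as the determinant of an $m(n)\times m(n)$ matrix whose entries are (possibly nonhomogeneous) linear functions over $\mathbb{C}$ of the entries of $X$. -/

import Mathlib

open scoped TensorProduct

noncomputable section

namespace GCT

/-! ### Polynomial functions, projective closures and coordinate rings -/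

section Geometry

variable {V : Type*} [AddCommGroup V] [Module ℂ V]

/-- The algebra of polynomial functions on a complex vector space `V`: the functions `V → ℂ`
that are polynomial expressions in linear functionals. -/
def polyFun (V : Type*) [AddCommGroup V] [Module ℂ V] : Subalgebra ℂ (V → ℂ) :=
  Algebra.adjoin ℂ (Set.range fun l : Module.Dual ℂ V => (l : V → ℂ))

/-- `F` is a homogeneous polynomial function of degree `d` on `V`. -/
def IsHomogeneousPolyFun (F : V → ℂ) (d : ℕ) : Prop :=
  F ∈ polyFun V ∧ ∀ (c : ℂ) (v : V), F (c • v) = c ^ d * F v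

/-- The Zariski closure of a set `S` of points of `ℙ(V)`: the common zero set of all homogeneous
polynomials that vanish on `S`. -/
def projClosure (S : Set (Projectivization ℂ V)) : Set (Projectivization ℂ V) :=
  {p | ∀ (d : ℕ) (F : V → ℂ), IsHomogeneousPolyFun F d →
    (∀ q ∈ S, F q.rep = 0) → F p.rep = 0}

/-- The affine cone in `V` over a set of points of `ℙ(V)` (the origin included). -/
def affineCone (X : Set (Projectivization ℂ V)) : Set V :=
  {v | ∀ hv : v ≠ 0, Projectivization.mk ℂ v hv ∈ X}

/-- Restriction of functions from `V` to a subset `Z`. -/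
def restrictHom (Z : Set V) : (V → ℂ) →ₐ[ℂ] (Z → ℂ) :=
  AlgHom.pi fun z : Z => Pi.evalAlgHom ℂ (fun _ : V => ℂ) (z : V)

/-- The ring of polynomial functions on a subset `Z` of `V`. If `Z` is the affine cone over a
projective variety `X`, this is the homogeneous coordinate ring of `X`. -/
def coordRing (Z : Set V) : Subalgebra ℂ (Z → ℂ) :=
  (polyFun V).map (restrictHom Z)

/-- Polynomial functions are stable under linear substitutions. -/
theorem polyFun_comp {F : V → ℂ} (hF : F ∈ polyFun V) (A : V →ₗ[ℂ] V) :
    (fun v => F (A v)) ∈ polyFun V := by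
  unfold polyFun at hF
  induction hF using Algebra.adjoin_induction with
  | mem x hx =>
    obtain ⟨l, rfl⟩ := hx
    exact Algebra.subset_adjoin ⟨l ∘ₗ A, rfl⟩
  | algebraMap r => exact (polyFun V).algebraMap_mem r
  | add x y _ _ hx hy => exact (polyFun V).add_mem hx hy
  | mul x y _ _ hx hy => exact (polyFun V).mul_mem hx hy

/-- Whether a homogeneous polynomial vanishes at a point of projective space does not depend on
the chosen representative. -/
theorem IsHomogeneousPolyFun.rep_eq_zero_iff {F : V → ℂ} {d : ℕ} (hF : IsHomogeneousPolyFun F d)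
    (v : V) (hv : v ≠ 0) : F (Projectivization.mk ℂ v hv).rep = 0 ↔ F v = 0 := by
  obtain ⟨a, ha⟩ := Projectivization.exists_smul_eq_mk_rep ℂ v hv
  rw [← ha, Units.smul_def, hF.2]
  simp

variable {G : Type*} [Group G]

/-- The orbit of the point `[f]` of `ℙ(V)` under a group acting linearly on `V`. -/
def projOrbit (ρ : Representation ℂ G V) (f : V) : Set (Projectivization ℂ V) :=
  {p | ∃ (g : G) (h : ρ g f ≠ 0), p = Projectivization.mk ℂ (ρ g f) h}

/-- The orbit closure of `[f]` in `ℙ(V)`, a projective variety. -/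
def orbitClosure (ρ : Representation ℂ G V) (f : V) : Set (Projectivization ℂ V) :=
  projClosure (projOrbit ρ f)

/-- The set `X` of points of `ℙ(V)` is stable under the group (stated for its affine cone). -/
def IsStable (ρ : Representation ℂ G V) (X : Set (Projectivization ℂ V)) : Prop :=
  ∀ g, ∀ v ∈ affineCone X, ρ g v ∈ affineCone X

/-- Orbit closures are stable under the group. -/
theorem orbitClosure_stable (ρ : Representation ℂ G V) (f : V) :
    IsStable ρ (orbitClosure ρ f) := by
  intro g v hv hgv d F hF hS
  have hv0 : v ≠ 0 := by
    rintro rfl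
    exact hgv (map_zero _)
  rw [hF.rep_eq_zero_iff]
  have hF' : IsHomogeneousPolyFun (fun w => F (ρ g w)) d :=
    ⟨polyFun_comp hF.1 (ρ g), fun c w => by simp only [map_smul, hF.2]⟩
  have := hv hv0 d _ hF' ?_
  · exact (hF'.rep_eq_zero_iff v hv0).1 this
  · rintro q ⟨k, hk, rfl⟩
    rw [hF'.rep_eq_zero_iff]
    have h1 : ρ g (ρ k f) = ρ (g * k) f := by rw [map_mul]; rfl
    have h2 : ρ (g * k) f ≠ 0 := by
      intro h0
      apply hk
      have : ρ g⁻¹ (ρ (g * k) f) = ρ k f := by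
        rw [← Module.End.mul_apply, ← map_mul, inv_mul_cancel_left]
      rw [← this, h0, map_zero]
    change F (ρ g (ρ k f)) = 0
    rw [h1, ← hF.rep_eq_zero_iff _ h2]
    exact hS _ ⟨g * k, h2, rfl⟩

/-- The action of `G` on functions on a stable subset of `V`: `(g F)(z) = F (g⁻¹ z)`. -/
def funRep (ρ : Representation ℂ G V) (Z : Set V) (hZ : ∀ g, ∀ v ∈ Z, ρ g v ∈ Z) :
    Representation ℂ G (Z → ℂ) where
  toFun g :=
    { toFun := fun F z => F ⟨ρ g⁻¹ z, hZ _ _ z.2⟩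
      map_add' := fun _ _ => rfl
      map_smul' := fun _ _ => rfl }
  map_one' := by
    ext F z
    simp
  map_mul' g h := by
    ext F z
    simp

/-- The action of `G` on the homogeneous coordinate ring of a stable subset `X` of `ℙ(V)`, the ring
of polynomial functions on the affine cone over `X`. -/
def coordRep (ρ : Representation ℂ G V) (X : Set (Projectivization ℂ V)) (hX : IsStable ρ X) :
    Representation ℂ G (Subalgebra.toSubmodule (coordRing (affineCone X))) :=
  (funRep ρ (affineCone X) hX).subrepresentation _ (by
    rintro g _ ⟨F, hF, rfl⟩
    exact ⟨fun v => F (ρ g⁻¹ v), polyFun_comp hF (ρ g⁻¹), rfl⟩)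

/-- The representation `σ` occurs in `τ`: it is isomorphic to a subrepresentation of `τ`. -/
def Occurs {H U W : Type*} [Monoid H] [AddCommMonoid U] [Module ℂ U]
    [AddCommMonoid W] [Module ℂ W]
    (σ : Representation ℂ H U) (τ : Representation ℂ H W) : Prop :=
  ∃ φ : Representation.IntertwiningMap σ τ, Function.Injective φ

end Geometry

/-! ### Weyl modules of the general linear group -/

section Weyl

variable (ι : Type*) [Fintype ι] [DecidableEq ι] (μ : YoungDiagram)

/-- The tensor power of the standard representation `ℂ^ι`, with tensor factors indexed by the
cells of the Young diagram `μ`. -/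
abbrev CellTensor : Type _ := ⨂[ℂ] _ : μ.cells, (ι → ℂ)

/-- The diagonal action of `GL(ι, ℂ)` on the tensor power. -/
def tensorRep : Representation ℂ (GL ι ℂ) (CellTensor ι μ) where
  toFun g := PiTensorProduct.map fun _ => Matrix.toLin' (g : Matrix ι ι ℂ)
  map_one' := by
    simp only [Units.val_one, Matrix.toLin'_one]
    exact PiTensorProduct.map_id
  map_mul' g h := by
    simp only [Units.val_mul, Matrix.toLin'_mul]
    exact PiTensorProduct.map_comp _ _

/-- The permutation of the tensor factors by a permutation of the cells. -/
def permTensor (p : Equiv.Perm μ.cells) : CellTensor ι μ →ₗ[ℂ] CellTensor ι μ :=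
  (PiTensorProduct.reindex ℂ (fun _ : μ.cells => ι → ℂ) p).toLinearMap

/-- The Young symmetrizer: symmetrize over the permutations of the cells that preserve every row,
then antisymmetrize over the permutations that preserve every column. -/
def youngSymmetrizer : CellTensor ι μ →ₗ[ℂ] CellTensor ι μ :=
  (∑ q : Equiv.Perm μ.cells with ∀ c, (q c).1.2 = c.1.2,
      ((Equiv.Perm.sign q : ℤ) : ℂ) • permTensor ι μ q) ∘ₗ
    (∑ p : Equiv.Perm μ.cells with ∀ c, (p c).1.1 = c.1.1, permTensor ι μ p)

/-- Permutations of the tensor factors commute with the action of `GL(ι, ℂ)`. -/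
theorem tensorRep_permTensor (g : GL ι ℂ) (p : Equiv.Perm μ.cells) (x : CellTensor ι μ) :
    tensorRep ι μ g (permTensor ι μ p x) = permTensor ι μ p (tensorRep ι μ g x) :=
  PiTensorProduct.map_reindex (fun _ : μ.cells => Matrix.toLin' (g : Matrix ι ι ℂ)) p x

theorem tensorRep_youngSymmetrizer (g : GL ι ℂ) (x : CellTensor ι μ) :
    tensorRep ι μ g (youngSymmetrizer ι μ x) = youngSymmetrizer ι μ (tensorRep ι μ g x) := by
  simp only [youngSymmetrizer, LinearMap.comp_apply, LinearMap.sum_apply, LinearMap.smul_apply,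
    map_sum, map_smul, tensorRep_permTensor]

/-- The Weyl module `V_μ` of `GL(ι, ℂ)`: the image of the Young symmetrizer of `μ` on the tensor
power of `ℂ^ι`. If `μ` has at most `#ι` rows, it is the irreducible polynomial representation
indexed by the partition `μ` (highest weight `μ`). -/
def weylRep : Representation ℂ (GL ι ℂ) (LinearMap.range (youngSymmetrizer ι μ)) :=
  (tensorRep ι μ).subrepresentation _ (by
    rintro g _ ⟨x, rfl⟩
    exact ⟨tensorRep ι μ g x, (tensorRep_youngSymmetrizer ι μ g x).symm⟩)

end Weyl

/-! ### The class varieties of the permanent and of the determinant -/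

section Forms

variable (ι : Type*) [Fintype ι]

/-- The linear change of variables `y ↦ A y` in polynomials in the variables `y_i`, `i ∈ ι`. -/
def linSubst (A : Matrix ι ι ℂ) : MvPolynomial ι ℂ →ₐ[ℂ] MvPolynomial ι ℂ :=
  MvPolynomial.aeval fun i => ∑ j, MvPolynomial.C (A i j) * MvPolynomial.X j

theorem linSubst_one [DecidableEq ι] : linSubst ι 1 = AlgHom.id ℂ _ := by
  ext i : 1
  simp [linSubst, Matrix.one_apply]

theorem linSubst_mul (A B : Matrix ι ι ℂ) :
    linSubst ι (A * B) = (linSubst ι B).comp (linSubst ι A) := by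
  ext i : 1
  simp only [linSubst, Matrix.mul_apply, MvPolynomial.aeval_X, AlgHom.comp_apply, map_sum,
    map_mul, MvPolynomial.algHom_C, MvPolynomial.algebraMap_eq, Finset.sum_mul, Finset.mul_sum]
  rw [Finset.sum_comm]
  simp only [mul_assoc]

theorem linSubst_isHomogeneous (A : Matrix ι ι ℂ) {f : MvPolynomial ι ℂ} {d : ℕ}
    (hf : f.IsHomogeneous d) : (linSubst ι A f).IsHomogeneous d := by
  have := hf.aeval (fun i => ∑ j, MvPolynomial.C (A i j) * MvPolynomial.X j) (n := 1)
    fun i => MvPolynomial.IsHomogeneous.sum _ _ _ fun j _ => by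
      simpa using (MvPolynomial.isHomogeneous_C ι (A i j)).mul (MvPolynomial.isHomogeneous_X ℂ j)
  rwa [one_mul] at this

/-- The action of `GL(ι, ℂ)` on the space of forms of degree `d` in the variables `y_i`, `i ∈ ι`:
`(g f)(y) = f (g⁻¹ y)`. -/
def formRep [DecidableEq ι] (d : ℕ) :
    Representation ℂ (GL ι ℂ) (MvPolynomial.homogeneousSubmodule ι ℂ d) where
  toFun g := (linSubst ι ((g⁻¹ : GL ι ℂ) : Matrix ι ι ℂ)).toLinearMap.restrict
    fun _ hf => linSubst_isHomogeneous ι _ hf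
  map_one' := by
    refine LinearMap.ext fun f => Subtype.ext ?_
    change linSubst ι (((1 : GL ι ℂ)⁻¹ : GL ι ℂ) : Matrix ι ι ℂ) f = f
    rw [inv_one, Units.val_one, linSubst_one]
    rfl
  map_mul' g h := by
    refine LinearMap.ext fun f => Subtype.ext ?_
    change linSubst ι (((g * h)⁻¹ : GL ι ℂ) : Matrix ι ι ℂ) f =
      linSubst ι ((g⁻¹ : GL ι ℂ) : Matrix ι ι ℂ) (linSubst ι ((h⁻¹ : GL ι ℂ) : Matrix ι ι ℂ) f)
    rw [mul_inv_rev, Units.val_mul, linSubst_mul]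
    rfl

end Forms

/-- The space `Sym^m(Y)` of forms of degree `m` in the entries of a variable `m × m` matrix `Y`. -/
abbrev Form (m : ℕ) : Type :=
  MvPolynomial.homogeneousSubmodule (Fin m × Fin m) ℂ m

/-- The form `det(Y)`, for the variable `m × m` matrix `Y`. -/
def detForm (m : ℕ) : Form m :=
  ⟨(Matrix.mvPolynomialX (Fin m) (Fin m) ℂ).det, by
    rw [MvPolynomial.mem_homogeneousSubmodule, Matrix.det_apply]
    refine MvPolynomial.IsHomogeneous.sum _ _ _ fun s _ => ?_
    refine (MvPolynomial.homogeneousSubmodule _ _ _).smul_of_tower_mem _ ?_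
    have := MvPolynomial.IsHomogeneous.prod Finset.univ
      (fun i => Matrix.mvPolynomialX (Fin m) (Fin m) ℂ (s i) i) (fun _ => 1)
      fun i _ => MvPolynomial.isHomogeneous_X _ _
    simpa using this⟩

/-- The form `y^(m-n) perm(X)` of degree `m`, where `X` is the principal `n × n` submatrix on the
first `n` indices of the variable `m × m` matrix `Y`, and `y` is a diagonal entry of `Y` outside
`X`. -/
def permForm (n m : ℕ) (h : n < m) : Form m :=
  ⟨MvPolynomial.X (⟨n, h⟩, ⟨n, h⟩) ^ (m - n) *
      ((Matrix.mvPolynomialX (Fin m) (Fin m) ℂ).submatrix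
        (Fin.castLE h.le) (Fin.castLE h.le)).permanent, by
    rw [MvPolynomial.mem_homogeneousSubmodule]
    have h1 : ((Matrix.mvPolynomialX (Fin m) (Fin m) ℂ).submatrix
        (Fin.castLE h.le) (Fin.castLE h.le)).permanent.IsHomogeneous n := by
      refine MvPolynomial.IsHomogeneous.sum _ _ _ fun s _ => ?_
      have := MvPolynomial.IsHomogeneous.prod Finset.univ
        (fun i => (Matrix.mvPolynomialX (Fin m) (Fin m) ℂ).submatrix
          (Fin.castLE h.le) (Fin.castLE h.le) (s i) i) (fun _ => 1)
        fun i _ => MvPolynomial.isHomogeneous_X _ _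
      simpa using this
    have h2 := ((MvPolynomial.isHomogeneous_X ℂ
      ((⟨n, h⟩, ⟨n, h⟩) : Fin m × Fin m)).pow (m - n)).mul h1
    have h3 : 1 * (m - n) + n = m := by omega
    rwa [h3] at h2⟩

/-- The class variety `X_NC(n, m)`: the closure of the `GL_{m²}(ℂ)`-orbit of `[det(Y)]` in the
projective space of forms of degree `m` in the entries of `Y` (it depends on `m` only). -/
def classVarietyNC (m : ℕ) : Set (Projectivization ℂ (Form m)) :=
  orbitClosure (formRep (Fin m × Fin m) m) (detForm m)

/-- The class variety `X_#P(n, m)`: the closure of the `GL_{m²}(ℂ)`-orbit of `[y^(m-n) perm(X)]`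
in the projective space of forms of degree `m` in the entries of `Y`. -/
def classVarietySharpP (n m : ℕ) (h : n < m) : Set (Projectivization ℂ (Form m)) :=
  orbitClosure (formRep (Fin m × Fin m) m) (permForm n m h)

/-- The Weyl module `V_μ` of `GL_{m²}(ℂ)` lives on a stable variety `X` of forms of degree `m` in
the entries of `Y`: it occurs in the homogeneous coordinate ring of `X`. -/
def LivesOn (m : ℕ) (μ : YoungDiagram) (X : Set (Projectivization ℂ (Form m)))
    (hX : IsStable (formRep (Fin m × Fin m) m) X) : Prop :=
  Occurs (weylRep (Fin m × Fin m) μ) (coordRep (formRep (Fin m × Fin m) m) X hX)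

/-- There is a geometric obstruction for `(n, m)`, `n < m`: a partition `μ` of length at most
`m²` such that the Weyl module `V_μ` of `GL_{m²}(ℂ)` lives on `X_#P(n, m)` but not on
`X_NC(n, m)`. -/
def ObstructionExists (n m : ℕ) : Prop :=
  ∃ h : n < m, ∃ μ : YoungDiagram, μ.colLen 0 ≤ m ^ 2 ∧
    LivesOn m μ (classVarietySharpP n m h) (orbitClosure_stable _ _) ∧
    ¬ LivesOn m μ (classVarietyNC m) (orbitClosure_stable _ _)

/-- The permanent of the variable `n × n` matrix `X` is linearly represented as the determinant of
an `m × m` matrix: the entries of the latter are polynomials of degree at most one (possibly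
nonhomogeneous linear functions) in the entries of `X`. -/
def PermIsDet (n m : ℕ) : Prop :=
  ∃ A : Matrix (Fin m) (Fin m) (MvPolynomial (Fin n × Fin n) ℂ),
    (∀ i j, (A i j).totalDegree ≤ 1) ∧
      (Matrix.mvPolynomialX (Fin n) (Fin n) ℂ).permanent = A.det

end GCT

end

/-! Suppose perm(X) = det(A) with A an m × m matrix of affine functions. Homogenizing A with the
extra variable y gives a linear substitution in the entries of Y that takes det(Y) to y^m perm(X/y)
= y^(m-n) perm(X) (`linSubst_homogenizeMatrix_det`). Its matrix B may be singular, but tI + B is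
invertible for all but finitely many t, so a homogeneous polynomial that vanishes on the orbit of
det(Y) also vanishes at t = 0 (`linSubst_mem_affineCone`). Hence X_#P ⊆ X_NC. Restriction is then an
equivariant surjection from the coordinate ring of X_NC onto that of X_#P. Since these rings are
semisimple, whatever occurs in the quotient occurs in the larger ring (`LivesOn.mono`), so there is
no obstruction. Part (ii) is part (i) at each n that has an obstruction.

Semisimplicity (`isSemisimpleRepresentation_coordRep_formRep`) rests on a form of the unitarian
trick: GL is closed under conjugate transposition, so orthogonal complements of invariant subspaces
of tensor powers of ℂ^ι are invariant. It passes to sums, subrepresentations and quotients, and the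
coordinate rings arise from tensor powers by these operations. -/

noncomputable section

namespace GCT

/-! ### Semisimple representations -/

section Semisimple

open Representation

variable {k G V W U : Type*} [Field k] [Monoid G] [AddCommGroup V] [Module k V]
  [AddCommGroup W] [Module k W] [AddCommGroup U] [Module k U]
  {ρ : Representation k G V} {σ : Representation k G W} {τ : Representation k G U}

theorem isSemisimpleRepresentation_of_surjective (f : IntertwiningMap ρ σ)
    (hf : Function.Surjective f) (h : IsSemisimpleRepresentation ρ) :
    IsSemisimpleRepresentation σ := by
  rw [isSemisimpleRepresentation_iff_isSemisimpleModule_asModule] at h ⊢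
  exact IsSemisimpleModule.of_surjective (IntertwiningMap.equivLinearMapAsModule ρ σ f) hf

theorem isSemisimpleRepresentation_of_injective (f : IntertwiningMap ρ σ)
    (hf : Function.Injective f) (h : IsSemisimpleRepresentation σ) :
    IsSemisimpleRepresentation ρ := by
  rw [isSemisimpleRepresentation_iff_isSemisimpleModule_asModule] at h ⊢
  exact IsSemisimpleModule.of_injective (IntertwiningMap.equivLinearMapAsModule ρ σ f) hf

/-- A representation generated by images of semisimple representations is semisimple. -/
theorem isSemisimpleRepresentation_of_forall_mem {κ : Type*} {E : κ → Type*}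
    [∀ i, AddCommGroup (E i)] [∀ i, Module k (E i)] {ε : ∀ i, Representation k G (E i)}
    (hε : ∀ i, IsSemisimpleRepresentation (ε i)) (f : ∀ i, IntertwiningMap (ε i) ρ)
    (hf : ∀ p : Submodule k V, (∀ i x, f i x ∈ p) → p = ⊤) :
    IsSemisimpleRepresentation ρ := by
  simp only [isSemisimpleRepresentation_iff_isSemisimpleModule_asModule] at hε ⊢
  let F i := IntertwiningMap.equivLinearMapAsModule (ε i) ρ (f i)
  refine isSemisimpleModule_of_isSemisimpleModule_submodule' (p := fun i => LinearMap.range (F i))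
    (fun i => haveI := hε i; IsSemisimpleModule.range (F i)) ?_
  have h := hf (Subrepresentation.ofSubmodule' (⨆ i, LinearMap.range (F i))).toSubmodule
    fun i x => (le_iSup (fun i => LinearMap.range (F i)) i : _)
      (LinearMap.mem_range_self (F i) x)
  have hx (x : V) : x ∈ (Subrepresentation.ofSubmodule'
      (⨆ i, LinearMap.range (F i))).toSubmodule := h ▸ Submodule.mem_top
  exact eq_top_iff.2 fun x _ => hx x

/-- A representation that occurs in a quotient of a semisimple representation occurs in it. -/
theorem exists_injective_of_surjective (h : IsSemisimpleRepresentation ρ)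
    (f : IntertwiningMap ρ σ) (hf : Function.Surjective f)
    (φ : IntertwiningMap τ σ) (hφ : Function.Injective φ) :
    ∃ ψ : IntertwiningMap τ ρ, Function.Injective ψ := by
  rw [isSemisimpleRepresentation_iff_isSemisimpleModule_asModule] at h
  -- A lift `s` of `φ` through `f` is injective because `f ∘ s = φ` is.
  obtain ⟨s, hs⟩ := IsSemisimpleModule.lifting_property
    (IntertwiningMap.equivLinearMapAsModule ρ σ f) hf
    (IntertwiningMap.equivLinearMapAsModule τ σ φ)
  refine ⟨(IntertwiningMap.equivLinearMapAsModule τ ρ).symm s, fun x y hxy => hφ ?_⟩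
  have hx : ∀ x, f (s x) = φ x := fun x => LinearMap.congr_fun hs x
  exact (hx x).symm.trans ((congrArg f hxy).trans (hx y))

end Semisimple

/-- A representation on a finite-dimensional Hermitian space whose image is closed under adjoints
is semisimple. -/
theorem isSemisimpleRepresentation_of_adjoint {G E : Type*} [Monoid G] [NormedAddCommGroup E]
    [InnerProductSpace ℂ E] [FiniteDimensional ℂ E] (ρ : Representation ℂ G E)
    (h : ∀ g, ∃ g', ρ g' = LinearMap.adjoint (ρ g)) :
    Representation.IsSemisimpleRepresentation ρ where
  exists_isCompl S := by
    refine ⟨⟨S.toSubmoduleᗮ, fun g v hv => ?_⟩, ?_⟩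
    · rw [Submodule.mem_orthogonal] at hv ⊢
      intro u hu
      -- Invariance of the complement: ⟨u, ρ(g)v⟩ = ⟨ρ(g)*u, v⟩, and ρ(g)* = ρ(g') preserves `S`.
      obtain ⟨g', hg'⟩ := h g
      rw [← LinearMap.adjoint_inner_left, ← hg']
      exact hv _ (S.apply_mem_toSubmodule g' hu)
    · have hc := Submodule.isCompl_orthogonal (K := S.toSubmodule)
      constructor
      · rw [disjoint_iff]
        exact Subrepresentation.toSubmodule_injective hc.inf_eq_bot
      · rw [codisjoint_iff]
        exact Subrepresentation.toSubmodule_injective hc.sup_eq_top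

/-! ### Tensor powers of matrices -/

section MatrixPower

variable {R n : Type*} [CommSemiring R]

/-- The `d`-th Kronecker power of a square matrix. -/
def kroneckerPow (d : ℕ) (A : Matrix n n R) : Matrix (Fin d → n) (Fin d → n) R :=
  Matrix.of fun b a => ∏ j, A (b j) (a j)

theorem kroneckerPow_apply (d : ℕ) (A : Matrix n n R) (b a : Fin d → n) :
    kroneckerPow d A b a = ∏ j, A (b j) (a j) := rfl

theorem kroneckerPow_one [DecidableEq n] (d : ℕ) : kroneckerPow d (1 : Matrix n n R) = 1 := by
  ext b a
  simp only [kroneckerPow_apply, Matrix.one_apply, Finset.prod_ite_zero, funext_iff]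
  simp

theorem kroneckerPow_mul [Fintype n] (d : ℕ) (A B : Matrix n n R) :
    kroneckerPow d (A * B) = kroneckerPow d A * kroneckerPow d B := by
  ext b a
  simp only [kroneckerPow_apply, Matrix.mul_apply, Finset.prod_univ_sum, Fintype.piFinset_univ,
    Finset.prod_mul_distrib]

theorem kroneckerPow_conjTranspose [StarRing R] (d : ℕ) (A : Matrix n n R) :
    kroneckerPow d A.conjTranspose = (kroneckerPow d A).conjTranspose := by
  ext b a
  simp [kroneckerPow_apply, Matrix.conjTranspose_apply]

variable (R n) in
/-- The `d`-th Kronecker power as a homomorphism of monoids. -/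
def kroneckerPowHom [Fintype n] [DecidableEq n] (d : ℕ) : Matrix n n R →* Matrix (Fin d → n) (Fin d → n) R where
  toFun := kroneckerPow d
  map_one' := kroneckerPow_one d
  map_mul' := kroneckerPow_mul d

end MatrixPower

/-! ### Representations given by matrices -/

section MatrixRep

variable {G n : Type*} [Group G] [Fintype n] [DecidableEq n]

/-- The representation on a Euclidean space given by a homomorphism to matrices. -/
def euclideanRep (M : G →* Matrix n n ℂ) : Representation ℂ G (EuclideanSpace ℂ n) :=
  (Matrix.toLpLinAlgEquiv 2 : Matrix n n ℂ ≃ₐ[ℂ] _).toMonoidHom.comp M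

theorem euclideanRep_apply (M : G →* Matrix n n ℂ) (g : G) (x : EuclideanSpace ℂ n) (b : n) :
    euclideanRep M g x b = ∑ a, M g b a * x a := rfl

/-- The set of values of a matrix representation is closed under conjugate transposition. -/
def IsStarClosed (M : G →* Matrix n n ℂ) : Prop :=
  ∀ g, ∃ g', M g' = (M g).conjTranspose

theorem IsStarClosed.isSemisimpleRepresentation {M : G →* Matrix n n ℂ} (hM : IsStarClosed M) :
    Representation.IsSemisimpleRepresentation (euclideanRep M) := by
  refine isSemisimpleRepresentation_of_adjoint _ fun g => ?_
  obtain ⟨g', hg'⟩ := hM g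
  refine ⟨g', ?_⟩
  have := Matrix.toEuclideanLin_conjTranspose_eq_adjoint (M g)
  rw [← hg'] at this
  exact this

theorem IsStarClosed.kroneckerPow {M : G →* Matrix n n ℂ} (hM : IsStarClosed M) (d : ℕ) :
    IsStarClosed ((kroneckerPowHom ℂ n d).comp M) := by
  intro g
  obtain ⟨g', hg'⟩ := hM g
  refine ⟨g', ?_⟩
  change GCT.kroneckerPow d (M g') = (GCT.kroneckerPow d (M g)).conjTranspose
  rw [hg', kroneckerPow_conjTranspose]

/-- The contragredient `g ↦ (M g⁻¹)ᵀ` of a matrix representation. -/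
def dualRep (M : G →* Matrix n n ℂ) : Representation ℂ G (n → ℂ) where
  toFun g := Matrix.toLin' (M g⁻¹).transpose
  map_one' := by simp; rfl
  map_mul' g h := by
    rw [mul_inv_rev, map_mul, Matrix.transpose_mul, Matrix.toLin'_mul]
    rfl

/-- Actions on functions evaluate at `g⁻¹`, which cancels the inverse in the contragredient and
leaves the transpose of `M g`. -/
theorem dualRep_inv_apply (M : G →* Matrix n n ℂ) (g : G) (x : n → ℂ) (a : n) :
    dualRep M g⁻¹ x a = ∑ b, M g b a * x b := by
  simp [dualRep, Matrix.mulVec, dotProduct]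

end MatrixRep

/-! ### Semisimplicity of the coordinate rings -/

section PolyRep

variable {G V W : Type*} [Group G] [AddCommGroup V] [Module ℂ V] [AddCommGroup W] [Module ℂ W]

/-- The action of `G` on the polynomial functions on `V`: `(g F)(v) = F (g⁻¹ v)`. -/
def polyRep (ρ : Representation ℂ G V) : Representation ℂ G (polyFun V) where
  toFun g :=
    { toFun := fun F => ⟨fun v => F.1 (ρ g⁻¹ v), polyFun_comp F.2 (ρ g⁻¹)⟩
      map_add' := fun _ _ => rfl
      map_smul' := fun _ _ => rfl }
  map_one' := by
    ext F v
    simp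
  map_mul' g h := by
    ext F v
    simp

theorem polyFun_comap {F : V → ℂ} (hF : F ∈ polyFun V) (A : W →ₗ[ℂ] V) :
    (fun v => F (A v)) ∈ polyFun W := by
  unfold polyFun at hF
  induction hF using Algebra.adjoin_induction with
  | mem x hx =>
    obtain ⟨l, rfl⟩ := hx
    exact Algebra.subset_adjoin ⟨l ∘ₗ A, rfl⟩
  | algebraMap r => exact (polyFun W).algebraMap_mem r
  | add x y _ _ hx hy => exact (polyFun W).add_mem hx hy
  | mul x y _ _ hx hy => exact (polyFun W).mul_mem hx hy

/-- Pullback of polynomial functions along an equivariant linear map. -/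
def polyRepComap {ρ : Representation ℂ G V} {σ : Representation ℂ G W}
    (π : Representation.IntertwiningMap σ ρ) :
    Representation.IntertwiningMap (polyRep ρ) (polyRep σ) where
  toFun F := ⟨fun w => F.1 (π w), polyFun_comap F.2 π.toLinearMap⟩
  map_add' _ _ := rfl
  map_smul' _ _ := rfl
  isIntertwining' g := by
    ext F w
    change F.1 (ρ g⁻¹ (π w)) = F.1 (π (σ g⁻¹ w))
    rw [π.isIntertwining]

theorem polyRepComap_injective {ρ : Representation ℂ G V} {σ : Representation ℂ G W}
    (π : Representation.IntertwiningMap σ ρ) (hπ : Function.Surjective π) :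
    Function.Injective (polyRepComap π) := by
  intro F F' h
  ext v
  obtain ⟨w, rfl⟩ := hπ v
  exact congrFun (congrArg Subtype.val h) w

/-- Restriction of polynomial functions to the affine cone over a stable set. -/
def polyRepRestrict (ρ : Representation ℂ G V) (X : Set (Projectivization ℂ V))
    (hX : IsStable ρ X) : Representation.IntertwiningMap (polyRep ρ) (coordRep ρ X hX) where
  toFun F := ⟨fun z => F.1 z, F.1, F.2, rfl⟩
  map_add' _ _ := rfl
  map_smul' _ _ := rfl
  isIntertwining' _ := rfl

theorem polyRepRestrict_surjective (ρ : Representation ℂ G V) (X : Set (Projectivization ℂ V))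
    (hX : IsStable ρ X) : Function.Surjective (polyRepRestrict ρ X hX) := by
  rintro ⟨_, F, hF, rfl⟩
  exact ⟨⟨F, hF⟩, rfl⟩

variable {n : Type*} [Fintype n]

/-- The monomial function `c ↦ ∏ j, c (α j)`. -/
def monomialFun {d : ℕ} (α : Fin d → n) : polyFun (n → ℂ) :=
  ⟨fun c => ∏ j, c (α j), by
    have h : (∏ j, fun c : n → ℂ => c (α j)) ∈ polyFun (n → ℂ) :=
      (polyFun (n → ℂ)).prod_mem fun j _ => Algebra.subset_adjoin ⟨LinearMap.proj (α j), rfl⟩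
    convert h using 1
    ext c
    simp⟩

/-- Functionals on `n → ℂ` are combinations of coordinates, so the algebra is spanned by products of
coordinates. Indexing these by sequences `α : Fin d → n` matches them with the standard basis of the
`d`-th tensor power. -/
theorem polyFun_pi_eq_span :
    Subalgebra.toSubmodule (polyFun (n → ℂ)) =
      Submodule.span ℂ (Set.range fun α : Σ d : ℕ, Fin d → n => (monomialFun α.2).1) := by
  classical
  have h1 : polyFun (n → ℂ) = Algebra.adjoin ℂ (Set.range fun (a : n) (c : n → ℂ) => c a) := by
    refine le_antisymm (Algebra.adjoin_le ?_) (Algebra.adjoin_mono ?_)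
    · rintro _ ⟨l, rfl⟩
      have hl : (l : (n → ℂ) → ℂ) = ∑ a, l (Pi.single a 1) • fun c : n → ℂ => c a := by
        ext c
        rw [Finset.sum_apply, LinearMap.pi_apply_eq_sum_univ l c]
        refine Finset.sum_congr rfl fun a _ => ?_
        rw [Pi.smul_apply, smul_eq_mul, smul_eq_mul, mul_comm]
        congr 2
        ext b
        simp [Pi.single_apply, eq_comm]
      rw [SetLike.mem_coe]
      change (l : (n → ℂ) → ℂ) ∈ Algebra.adjoin ℂ (Set.range fun (a : n) (c : n → ℂ) => c a)
      rw [hl]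
      exact Subalgebra.sum_mem _ fun a _ =>
        Subalgebra.smul_mem _ (Algebra.subset_adjoin (Set.mem_range_self a)) _
    · rintro _ ⟨a, rfl⟩
      exact ⟨LinearMap.proj a, rfl⟩
  refine le_antisymm ?_ (Submodule.span_le.2 ?_)
  · have h2 := congrArg Subalgebra.toSubmodule h1
    rw [Algebra.adjoin_eq_span] at h2
    refine h2.le.trans ?_
    refine Submodule.span_mono fun F hF => ?_
    induction hF using Submonoid.closure_induction with
    | mem x hx =>
      obtain ⟨a, rfl⟩ := hx
      refine ⟨⟨1, fun _ => a⟩, ?_⟩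
      ext c
      simp [monomialFun]
    | one => exact ⟨⟨0, Fin.elim0⟩, by ext c; simp [monomialFun]⟩
    | mul x y _ _ hx hy =>
      obtain ⟨⟨d, α⟩, rfl⟩ := hx
      obtain ⟨⟨e, β⟩, rfl⟩ := hy
      refine ⟨⟨d + e, Fin.append α β⟩, ?_⟩
      ext c
      simp [monomialFun, Fin.prod_univ_add]
  · rintro _ ⟨α, rfl⟩
    exact (monomialFun α.2).2

variable [DecidableEq n]

/-- The equivariant map from the `d`-th tensor power to the polynomial functions of degree `d` on
the dual space. -/
def tensorToPoly (M : G →* Matrix n n ℂ) (d : ℕ) :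
    Representation.IntertwiningMap (euclideanRep ((kroneckerPowHom ℂ n d).comp M))
      (polyRep (dualRep M)) where
  toFun x := ∑ α, x α • monomialFun α
  map_add' x y := by simp [add_smul, Finset.sum_add_distrib]
  map_smul' c x := by simp [Finset.smul_sum, mul_smul]
  isIntertwining' g := by
    refine LinearMap.ext fun x => Subtype.ext (funext fun c => ?_)
    have hsum : ∀ (x : (Fin d → n) → ℂ) (c : n → ℂ),
        (∑ α, x α • monomialFun α : polyFun (n → ℂ)).1 c = ∑ α, x α * ∏ j, c (α j) := by
      intro x c
      rw [AddSubmonoidClass.coe_finsetSum, Finset.sum_apply]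
      rfl
    change (∑ α, _ • monomialFun α : polyFun (n → ℂ)).1 c =
      (∑ α, x α • monomialFun α : polyFun (n → ℂ)).1 (dualRep M g⁻¹ c)
    rw [hsum, hsum]
    -- Expanding the product over `j` of the sums over `b` produces exactly the entries of the
    -- Kronecker power.
    simp only [euclideanRep_apply, dualRep_inv_apply, Finset.prod_univ_sum, Fintype.piFinset_univ,
      Finset.sum_mul, Finset.mul_sum]
    rw [Finset.sum_comm]
    refine Finset.sum_congr rfl fun a _ => Finset.sum_congr rfl fun b _ => ?_
    change (∏ j, M g (b j) (a j)) * x a * _ = _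
    rw [Finset.prod_mul_distrib]
    ring

theorem tensorToPoly_single (M : G →* Matrix n n ℂ) (d : ℕ) (α : Fin d → n) :
    tensorToPoly M d (EuclideanSpace.single α 1) = monomialFun α := by
  change ∑ β, _ • monomialFun β = _
  rw [Finset.sum_eq_single α] <;> simp +contextual

/-- The space of polynomial functions need not be finite-dimensional, but the images of the
finite-dimensional tensor powers, each semisimple, together contain every monomial. -/
theorem IsStarClosed.polyRep_dualRep {M : G →* Matrix n n ℂ} (hM : IsStarClosed M) :
    Representation.IsSemisimpleRepresentation (polyRep (dualRep M)) := by
  refine isSemisimpleRepresentation_of_forall_mem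
    (fun d => (hM.kroneckerPow d).isSemisimpleRepresentation) (tensorToPoly M) fun p hp => ?_
  have h : Subalgebra.toSubmodule (polyFun (n → ℂ)) ≤
      p.map (Subalgebra.toSubmodule (polyFun (n → ℂ))).subtype := by
    refine polyFun_pi_eq_span.le.trans (Submodule.span_le.2 ?_)
    rintro _ ⟨⟨d, α⟩, rfl⟩
    exact ⟨monomialFun α, tensorToPoly_single M d α ▸ hp d _, rfl⟩
  refine eq_top_iff.2 fun F _ => ?_
  obtain ⟨F', hF', h'⟩ := h F.2
  rwa [← Subtype.ext h']

end PolyRep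

/-! ### The coordinate rings of varieties of forms -/

section FormRep

variable (ι : Type*) [Fintype ι] [DecidableEq ι] (m : ℕ)

/-- The matrices of `GL(ι, ℂ)` on the `m`-th tensor power of `ℂ^ι`. -/
def glTensorPow : GL ι ℂ →* Matrix (Fin m → ι) (Fin m → ι) ℂ :=
  (kroneckerPowHom ℂ ι m).comp (Units.coeHom _)

theorem isStarClosed_glTensorPow : IsStarClosed (glTensorPow ι m) := by
  -- The conjugate transpose of an invertible matrix is invertible.
  have h : IsStarClosed (Units.coeHom (Matrix ι ι ℂ)) := fun g => ⟨star g, rfl⟩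
  exact h.kroneckerPow m

/-- Symmetrization: the form `∑ c(a) X_{a(1)} ⋯ X_{a(m)}` with coefficient tensor `c`. -/
def tensorToForm : Representation.IntertwiningMap (dualRep (glTensorPow ι m)) (formRep ι m) where
  toFun c := ⟨∑ a, c a • ∏ k, MvPolynomial.X (a k), by
    refine Submodule.sum_mem _ fun a _ => Submodule.smul_mem _ _ ?_
    have := MvPolynomial.IsHomogeneous.prod Finset.univ
      (fun k => (MvPolynomial.X (a k) : MvPolynomial ι ℂ)) (fun _ => 1)
      fun _ _ => MvPolynomial.isHomogeneous_X _ _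
    simpa using this⟩
  map_add' x y := by
    ext1
    simp [add_smul, Finset.sum_add_distrib]
  map_smul' c x := by
    ext1
    simp [Finset.smul_sum, mul_smul]
  isIntertwining' g := by
    refine LinearMap.ext fun c => Subtype.ext ?_
    -- With `g⁻¹` in place of `g`, both sides involve the matrix of `g` itself.
    obtain ⟨g, rfl⟩ := inv_surjective g
    change ∑ a, (dualRep (glTensorPow ι m) g⁻¹ c a) • ∏ k, MvPolynomial.X (a k) =
      linSubst ι ((g⁻¹⁻¹ : GL ι ℂ) : Matrix ι ι ℂ) (∑ a, c a • ∏ k, MvPolynomial.X (a k))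
    have hmon : ∀ a : Fin m → ι, linSubst ι (g : Matrix ι ι ℂ) (∏ k, MvPolynomial.X (a k)) =
        ∑ b : Fin m → ι, glTensorPow ι m g a b • ∏ k, MvPolynomial.X (b k) := by
      intro a
      rw [linSubst, map_prod]
      simp only [MvPolynomial.aeval_X, Finset.prod_univ_sum, Fintype.piFinset_univ,
        Finset.prod_mul_distrib]
      refine Finset.sum_congr rfl fun b _ => ?_
      rw [← map_prod, ← MvPolynomial.smul_eq_C_mul]
      rfl
    simp only [inv_inv, dualRep_inv_apply, map_sum, map_smul, hmon, Finset.sum_smul,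
      Finset.smul_sum]
    rw [Finset.sum_comm]
    simp only [smul_smul, mul_comm]

theorem tensorToForm_surjective : Function.Surjective (tensorToForm ι m) := by
  rintro ⟨f, hf⟩
  let T := (LinearMap.range (tensorToForm ι m).toLinearMap).map
    (MvPolynomial.homogeneousSubmodule ι ℂ m).subtype
  suffices h : f ∈ T by
    obtain ⟨_, ⟨c, rfl⟩, h⟩ := h
    exact ⟨c, Subtype.ext h⟩
  rw [f.as_sum]
  refine Submodule.sum_mem _ fun s hs => ?_
  have hdeg : s.degree = m := by
    rw [MvPolynomial.mem_homogeneousSubmodule] at hf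
    have := hf (MvPolynomial.mem_support_iff.1 hs)
    rwa [Finsupp.degree_eq_weight_one]
  -- Listing the variables of the monomial with multiplicity gives a sequence of length `m`; the
  -- basis tensor at this sequence maps to the monomial.
  obtain ⟨a, ha⟩ : ∃ a : Fin m → ι, s = ∑ k, Finsupp.single (a k) 1 := by
    have hcard : s.toMultiset.toList.length = m := by
      rw [Multiset.length_toList, Finsupp.card_toMultiset]
      exact hdeg
    subst hcard
    refine ⟨s.toMultiset.toList.get, ?_⟩
    have hlist : ∀ L : List ι, (L : Multiset ι).toFinsupp =
        ∑ k, Finsupp.single (L.get k) 1 := by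
      intro L
      induction L with
      | nil => simp
      | cons a L ih =>
        rw [← Multiset.cons_coe, ← Multiset.singleton_add, map_add, ih]
        exact ((Fin.sum_univ_succ (n := L.length)
          fun k => Finsupp.single ((a :: L).get k) 1).trans (by simp)).symm
    rw [← hlist, Multiset.coe_toList, Finsupp.toMultiset_toFinsupp]
  rw [← mul_one (f.coeff s), ← smul_eq_mul, ← MvPolynomial.smul_monomial]
  refine T.smul_mem _ ⟨_, ⟨Pi.single a 1, rfl⟩, ?_⟩
  change ∑ b, (Pi.single a 1 : (Fin m → ι) → ℂ) b • ∏ k, MvPolynomial.X (b k) = _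
  rw [Finset.sum_eq_single a]
  · simp [ha, MvPolynomial.monomial_sum_one, MvPolynomial.X]
  · intro b _ hb
    simp [hb]
  · simp

/-- The homogeneous coordinate ring of a stable set of forms is a semisimple representation. -/
theorem isSemisimpleRepresentation_coordRep_formRep
    (X : Set (Projectivization ℂ (MvPolynomial.homogeneousSubmodule ι ℂ m)))
    (hX : IsStable (formRep ι m) X) :
    Representation.IsSemisimpleRepresentation (coordRep (formRep ι m) X hX) :=
  -- The coordinate ring is a quotient of the polynomial functions on forms; these embed, by
  -- pullback along the surjection `tensorToForm`, in the polynomial functions on coefficient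
  -- tensors.
  isSemisimpleRepresentation_of_surjective (polyRepRestrict _ X hX)
    (polyRepRestrict_surjective _ X hX)
    (isSemisimpleRepresentation_of_injective (polyRepComap (tensorToForm ι m))
      (polyRepComap_injective _ (tensorToForm_surjective ι m))
      (isStarClosed_glTensorPow ι m).polyRep_dualRep)

end FormRep

/-! ### Inclusions of varieties and coordinate rings -/

section Inclusion

variable {G V : Type*} [Group G] [AddCommGroup V] [Module ℂ V]

theorem affineCone_mono {X Y : Set (Projectivization ℂ V)} (h : X ⊆ Y) :
    affineCone X ⊆ affineCone Y :=
  fun _ hv hv0 => h (hv hv0)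

/-- The restriction map of homogeneous coordinate rings for stable sets `X ⊆ Y`. -/
def coordRestrict (ρ : Representation ℂ G V) {X Y : Set (Projectivization ℂ V)} (h : X ⊆ Y)
    (hX : IsStable ρ X) (hY : IsStable ρ Y) :
    Representation.IntertwiningMap (coordRep ρ Y hY) (coordRep ρ X hX) where
  toFun F := ⟨fun z => F.1 ⟨z, affineCone_mono h z.2⟩, by
    obtain ⟨F', hF', hF⟩ := F.2
    exact ⟨F', hF', funext fun z => congrFun hF ⟨z, affineCone_mono h z.2⟩⟩⟩
  map_add' _ _ := rfl
  map_smul' _ _ := rfl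
  isIntertwining' _ := rfl

theorem coordRestrict_surjective (ρ : Representation ℂ G V) {X Y : Set (Projectivization ℂ V)}
    (h : X ⊆ Y) (hX : IsStable ρ X) (hY : IsStable ρ Y) :
    Function.Surjective (coordRestrict ρ h hX hY) := by
  rintro ⟨_, F, hF, rfl⟩
  exact ⟨⟨_, F, hF, rfl⟩, rfl⟩

/-- The orbit closure of `f'` is stable, so it contains the orbit of `f`; being closed, it contains
the closure of that orbit. -/
theorem orbitClosure_subset (ρ : Representation ℂ G V) {f f' : V}
    (h : f ∈ affineCone (orbitClosure ρ f')) : orbitClosure ρ f ⊆ orbitClosure ρ f' := by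
  intro p hp d F hF hS
  refine hp d F hF ?_
  rintro q ⟨g, hg, rfl⟩
  exact orbitClosure_stable ρ f' g f h hg d F hF hS

end Inclusion

theorem LivesOn.mono {m : ℕ} {μ : YoungDiagram} {X Y : Set (Projectivization ℂ (Form m))}
    {hX : IsStable (formRep (Fin m × Fin m) m) X} (h : LivesOn m μ X hX) (hXY : X ⊆ Y)
    (hY : IsStable (formRep (Fin m × Fin m) m) Y) : LivesOn m μ Y hY := by
  obtain ⟨φ, hφ⟩ := h
  exact exists_injective_of_surjective 
    (U := LinearMap.range (youngSymmetrizer (Fin m × Fin m) μ))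
    (isSemisimpleRepresentation_coordRep_formRep (Fin m × Fin m) m Y hY)
    (coordRestrict _ hXY hX hY) (coordRestrict_surjective _ hXY hX hY)
    φ hφ

/-! ### Degenerations -/

/-- Along a curve `c` with polynomial coordinates, a polynomial function becomes a polynomial in the
parameter, so it is determined by its values at all but finitely many points. -/
theorem exists_polynomial_of_mem_polyFun {V : Type*} [AddCommGroup V] [Module ℂ V] {c : ℂ → V}
    (hc : ∀ l : Module.Dual ℂ V, ∃ p : Polynomial ℂ, ∀ t, p.eval t = l (c t))
    {F : V → ℂ} (hF : F ∈ polyFun V) : ∃ p : Polynomial ℂ, ∀ t, p.eval t = F (c t) := by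
  unfold polyFun at hF
  induction hF using Algebra.adjoin_induction with
  | mem x hx =>
    obtain ⟨l, rfl⟩ := hx
    exact hc l
  | algebraMap r => exact ⟨Polynomial.C r, fun t => by simp⟩
  | add x y _ _ hx hy =>
    obtain ⟨p, hp⟩ := hx
    obtain ⟨q, hq⟩ := hy
    exact ⟨p + q, fun t => by simp [hp, hq]⟩
  | mul x y _ _ hx hy =>
    obtain ⟨p, hp⟩ := hx
    obtain ⟨q, hq⟩ := hy
    exact ⟨p * q, fun t => by simp [hp, hq]⟩

section Degeneration

variable {ι : Type*} [Fintype ι] [DecidableEq ι]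

/-- The substitution is carried out once with an indeterminate in place of `t`; the coefficients of
`Q` are polynomials in the original variables. -/
theorem exists_polynomial_linSubst (A : Matrix ι ι ℂ) (f : MvPolynomial ι ℂ) :
    ∃ Q : Polynomial (MvPolynomial ι ℂ),
      ∀ t : ℂ, Q.eval (MvPolynomial.C t) = linSubst ι (Matrix.scalar ι t + A) f := by
  refine ⟨MvPolynomial.aeval (fun i => Polynomial.X * Polynomial.C (MvPolynomial.X i) +
    Polynomial.C (∑ j, MvPolynomial.C (A i j) * MvPolynomial.X j)) f, fun t => ?_⟩
  induction f using MvPolynomial.induction_on with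
  | C a =>
    simp [linSubst, MvPolynomial.algebraMap_eq, Polynomial.algebraMap_apply]
  | add p q hp hq => simp only [map_add, Polynomial.eval_add, hp, hq]
  | mul_X p i hp =>
    simp only [map_mul, Polynomial.eval_mul, hp]
    congr 1
    simp [linSubst, add_mul, Finset.sum_add_distrib, Matrix.diagonal_apply,
      Polynomial.eval_finsetSum, apply_ite MvPolynomial.C, mul_comm (MvPolynomial.X i)]

theorem exists_polynomial_dual {d : ℕ} (A : Matrix ι ι ℂ)
    (f : MvPolynomial.homogeneousSubmodule ι ℂ d)
    (l : Module.Dual ℂ (MvPolynomial.homogeneousSubmodule ι ℂ d)) :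
    ∃ p : Polynomial ℂ, ∀ t, p.eval t = l ⟨linSubst ι (Matrix.scalar ι t + A) f,
      linSubst_isHomogeneous ι _ f.2⟩ := by
  -- The coefficients of `Q` are not known to be homogeneous of degree `d`, so `l` is extended to
  -- all polynomials before being applied to them.
  obtain ⟨l', hl'⟩ := LinearMap.exists_extend l
  obtain ⟨Q, hQ⟩ := exists_polynomial_linSubst A f.1
  refine ⟨∑ k ∈ Finset.range (Q.natDegree + 1), Polynomial.monomial k (l' (Q.coeff k)),
    fun t => ?_⟩
  have h : l' (linSubst ι (Matrix.scalar ι t + A) f) = l ⟨linSubst ι (Matrix.scalar ι t + A) f,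
      linSubst_isHomogeneous ι _ f.2⟩ := 
    LinearMap.congr_fun hl' ⟨_, linSubst_isHomogeneous ι _ f.2⟩
  rw [← h, ← hQ, Polynomial.eval_eq_sum_range (p := Q), map_sum, Polynomial.eval_finsetSum]
  refine Finset.sum_congr rfl fun k _ => ?_
  rw [Polynomial.eval_monomial, ← map_pow, mul_comm (Q.coeff k), ← MvPolynomial.smul_eq_C_mul,
    map_smul, smul_eq_mul, mul_comm]

/-- Linear substitutions, invertible or not, stay in the orbit closure. -/
theorem linSubst_mem_affineCone {d : ℕ} (A : Matrix ι ι ℂ)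
    (f : MvPolynomial.homogeneousSubmodule ι ℂ d) :
    (⟨linSubst ι A f, linSubst_isHomogeneous ι A f.2⟩ : MvPolynomial.homogeneousSubmodule ι ℂ d) ∈
      affineCone (orbitClosure (formRep ι d) f) := by
  intro hv k F hF hS
  rw [hF.rep_eq_zero_iff]
  obtain ⟨p, hp⟩ := exists_polynomial_of_mem_polyFun (exists_polynomial_dual A f) hF.1
  have hf : f ≠ 0 := by
    rintro rfl
    exact hv (Subtype.ext (map_zero _))
  -- The value of this characteristic polynomial at `t` is det(tI + A). Where it is nonzero, the
  -- substituted form lies in the orbit and `p` vanishes. As the characteristic polynomial is monic,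
  -- `p = 0`; evaluation at `t = 0` then gives the claim.
  have hpq : p * (-A).charpoly = 0 := by
    refine Polynomial.funext fun t => ?_
    rw [Polynomial.eval_mul, Matrix.eval_charpoly, sub_neg_eq_add, Polynomial.eval_zero, mul_eq_zero,
      or_iff_not_imp_right, hp]
    intro hdet
    obtain ⟨u, hu⟩ := (Matrix.isUnit_iff_isUnit_det _).2 (isUnit_iff_ne_zero.2 hdet)
    -- The group element is `u⁻¹` because `formRep` substitutes the inverse matrix.
    have hg : formRep ι d u⁻¹ f = ⟨linSubst ι (Matrix.scalar ι t + A) f,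
        linSubst_isHomogeneous ι _ f.2⟩ := by
      refine Subtype.ext ?_
      change linSubst ι ((u⁻¹⁻¹ : GL ι ℂ) : Matrix ι ι ℂ) f = _
      rw [inv_inv, hu]
    rw [← hg]
    have h0 : formRep ι d u⁻¹ f ≠ 0 := by
      intro h0
      refine hf ?_
      rw [← Representation.inv_self_apply (formRep ι d) u⁻¹ f, h0, map_zero]
    rw [← hF.rep_eq_zero_iff _ h0]
    exact hS _ ⟨_, h0, rfl⟩
  have hp0 : p = 0 := (mul_eq_zero.1 hpq).resolve_right (Matrix.charpoly_monic _).ne_zero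
  have := hp 0
  simpa [hp0] using this.symm

end Degeneration

/-! ### Homogenization of determinantal representations -/

section Homogenize

theorem eval_eq_of_totalDegree_le_one {σ R : Type*} [Fintype σ] [DecidableEq σ] [CommSemiring R]
    {p : MvPolynomial σ R} (hp : p.totalDegree ≤ 1) (v : σ → R) :
    MvPolynomial.eval v p = p.coeff 0 + ∑ k, p.coeff (Finsupp.single k 1) * v k := by
  have h : p = MvPolynomial.C (p.coeff 0) +
      ∑ k, MvPolynomial.C (p.coeff (Finsupp.single k 1)) * MvPolynomial.X k := by
    ext s
    simp only [MvPolynomial.coeff_add, MvPolynomial.coeff_C, MvPolynomial.coeff_sum,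
      MvPolynomial.coeff_C_mul, MvPolynomial.coeff_X, mul_ite, mul_one, mul_zero]
    by_cases hs : s.degree ≤ 1
    · rcases Nat.le_one_iff_eq_zero_or_eq_one.1 hs with h0 | h1
      · rw [Finsupp.degree_eq_zero_iff] at h0
        subst h0
        simp
      · obtain ⟨k, rfl⟩ : ∃ k, s = Finsupp.single k 1 := by
          obtain ⟨k, hk⟩ := Multiset.card_eq_one.1 ((Finsupp.card_toMultiset s).trans h1)
          exact ⟨k, by rw [← Finsupp.toMultiset_toFinsupp s, hk, Multiset.toFinsupp_singleton]⟩
        have h0 : (0 : σ →₀ ℕ) ≠ Finsupp.single k 1 := by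
          simp [eq_comm]
        simp [Finsupp.single_left_inj, h0]
    · have h1 : p.coeff s = 0 := by
        refine MvPolynomial.coeff_eq_zero_of_totalDegree_lt (lt_of_le_of_lt hp ?_)
        exact not_le.1 hs
      have h2 : (0 : σ →₀ ℕ) ≠ s := by
        rintro rfl
        simp at hs
      have h3 : ∀ k, Finsupp.single k 1 ≠ s := by
        rintro k rfl
        simp at hs
      simp [h1, h2, h3]
  conv_lhs => rw [h]
  simp

/-- The matrix of the homogenization of a matrix of affine functions of the entries of the
principal `n × n` submatrix, the entry at `(n, n)` being the homogenizing variable. -/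
def homogenizeMatrix {n m : ℕ} (h : n < m)
    (A : Matrix (Fin m) (Fin m) (MvPolynomial (Fin n × Fin n) ℂ)) :
    Matrix (Fin m × Fin m) (Fin m × Fin m) ℂ :=
  Matrix.of fun i k => (A i.1 i.2).coeff 0 * (if k = (⟨n, h⟩, ⟨n, h⟩) then 1 else 0) +
    ∑ l : Fin n × Fin n, (A i.1 i.2).coeff (Finsupp.single l 1) *
      (if k = (l.1.castLE h.le, l.2.castLE h.le) then 1 else 0)

/-- Homogenization of an affine function: a(x) becomes y·a(x/y), which is linear in (y, x) and can
be evaluated in this way where y ≠ 0. -/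
theorem sum_homogenizeMatrix_mul {n m : ℕ} (h : n < m)
    {A : Matrix (Fin m) (Fin m) (MvPolynomial (Fin n × Fin n) ℂ)}
    (hA : ∀ i j, (A i j).totalDegree ≤ 1) (v : Fin m × Fin m → ℂ)
    (hv : v (⟨n, h⟩, ⟨n, h⟩) ≠ 0) (i : Fin m × Fin m) :
    ∑ k, homogenizeMatrix h A i k * v k = v (⟨n, h⟩, ⟨n, h⟩) *
      MvPolynomial.eval (fun l => (v (⟨n, h⟩, ⟨n, h⟩))⁻¹ * v (l.1.castLE h.le, l.2.castLE h.le))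
        (A i.1 i.2) := by
  rw [eval_eq_of_totalDegree_le_one (hA _ _)]
  simp only [homogenizeMatrix, Matrix.of_apply, add_mul, Finset.sum_add_distrib, Finset.sum_mul]
  rw [Finset.sum_comm]
  simp only [mul_ite, mul_one, mul_zero, ite_mul, zero_mul, Finset.sum_ite_eq',
    Finset.mem_univ, if_true, mul_add, Finset.mul_sum]
  refine congrArg₂ _ (mul_comm _ _) (Finset.sum_congr rfl fun l _ => ?_)
  rw [mul_left_comm, mul_inv_cancel_left₀ hv]

theorem eval_permanent_mvPolynomialX_submatrix {n : ℕ} {σ : Type*} (e : Fin n → σ)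
    (v : σ × σ → ℂ) :
    MvPolynomial.eval v ((Matrix.mvPolynomialX σ σ ℂ).submatrix e e).permanent =
      ∑ s : Equiv.Perm (Fin n), ∏ i, v (e (s i), e i) := by
  simp [Matrix.permanent]

theorem linSubst_homogenizeMatrix_det {n m : ℕ} (h : n < m)
    {A : Matrix (Fin m) (Fin m) (MvPolynomial (Fin n × Fin n) ℂ)}
    (hA : ∀ i j, (A i j).totalDegree ≤ 1)
    (hdet : (Matrix.mvPolynomialX (Fin n) (Fin n) ℂ).permanent = A.det) :
    linSubst (Fin m × Fin m) (homogenizeMatrix h A) (detForm m).1 = (permForm n m h).1 := by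
  set y : Fin m × Fin m := (⟨n, h⟩, ⟨n, h⟩) with hy
  -- After multiplication by the variable `y`, the two sides agree trivially at points where `y`
  -- vanishes, so division by the value of `y` is allowed in the remaining check.
  refine mul_left_cancel₀ (MvPolynomial.X_ne_zero y) (MvPolynomial.funext fun v => ?_)
  rw [map_mul, map_mul, MvPolynomial.eval_X]
  by_cases hv : v y = 0
  · rw [hv, zero_mul, zero_mul]
  congr 1
  set w : Fin n × Fin n → ℂ := fun l => (v y)⁻¹ * v (l.1.castLE h.le, l.2.castLE h.le) with hw
  have h1 : MvPolynomial.eval v (linSubst (Fin m × Fin m) (homogenizeMatrix h A) (detForm m).1) =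
      (v y • (MvPolynomial.eval w).mapMatrix A).det := by
    change ((MvPolynomial.eval v).comp
      (linSubst (Fin m × Fin m) (homogenizeMatrix h A)).toRingHom)
        (Matrix.mvPolynomialX (Fin m) (Fin m) ℂ).det = _
    rw [RingHom.map_det]
    congr 1
    ext i j
    have := sum_homogenizeMatrix_mul h hA v hv (i, j)
    simpa [linSubst] using this
  have h2 : MvPolynomial.eval v (permForm n m h).1 = v y ^ (m - n) *
      ∑ s : Equiv.Perm (Fin n), ∏ i, v ((s i).castLE h.le, i.castLE h.le) := by
    rw [← eval_permanent_mvPolynomialX_submatrix (Fin.castLE h.le) v]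
    simp [permForm, hy]
  have h3 := eval_permanent_mvPolynomialX_submatrix (id : Fin n → Fin n) w
  rw [Matrix.submatrix_id_id, hdet] at h3
  rw [h1, h2, Matrix.det_smul, ← RingHom.map_det, h3, Fintype.card_fin]
  simp only [hw, id, Finset.prod_mul_distrib, Finset.prod_const, Finset.card_univ,
    Fintype.card_fin, ← Finset.mul_sum]
  rw [← mul_assoc]
  congr 1
  -- The `m × m` determinant contributes y^m and the rescaled permanent of size `n` contributes
  -- y^(-n).
  rw [inv_pow, ← div_eq_mul_inv, pow_sub₀ _ hv h.le, div_eq_mul_inv]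

end Homogenize

theorem classVarietySharpP_subset_of_permIsDet {n m : ℕ} (h : n < m) (hP : PermIsDet n m) :
    classVarietySharpP n m h ⊆ classVarietyNC m := by
  obtain ⟨A, hA, hdet⟩ := hP
  refine orbitClosure_subset _ ?_
  have heq : (⟨_, linSubst_isHomogeneous _ (homogenizeMatrix h A) (detForm m).2⟩ : Form m) =
      permForm n m h := Subtype.ext (linSubst_homogenizeMatrix_det h hA hdet)
  exact heq ▸ linSubst_mem_affineCone (homogenizeMatrix h A) (detForm m)

theorem ObstructionExists.not_permIsDet {n m : ℕ} (h : ObstructionExists n m) :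
    ¬ PermIsDet n m := by
  obtain ⟨hnm, μ, -, hP, hNC⟩ := h
  exact fun hdet => hNC (hP.mono (classVarietySharpP_subset_of_permIsDet hnm hdet) _)

end GCT

end

theorem proposition9p2 :
    (∀ n m : ℕ, GCT.ObstructionExists n m → ¬ GCT.PermIsDet n m) ∧
    (∀ (a : ℝ) (ha : 1 < a) (m : ℕ → ℕ)
      (hm : ∀ n, m n = ⌈(2 : ℝ) ^ (Real.logb 2 n ^ a)⌉₊),
      (∀ᶠ n in Filter.atTop, GCT.ObstructionExists n (m n)) →
        ∀ᶠ n in Filter.atTop, ¬ GCT.PermIsDet n (m n)) :=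
  ⟨fun _ _ h => h.not_permIsDet,
    fun _ _ _ _ h => h.mono fun _ hn => hn.not_permIsDet⟩
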